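/- Fix a dimension $d$ and a norm $\|\cdot\|$ on $\mathbb{R}^d$, and let $\beta\in\mathbb{N}$ be a Besicovitch constant of $(\mathbb{R}^d,\|\cdot\|)$: for every $P\subseteq\mathbb{R}^d$ and $\delta>0$ there are $\beta$ families, each consisting of countably many pairwise disjoint closed balls of radius $\delta$ centred in $P$, whose union covers $P$. Let $X_1,X_2,\dots$ be independent points of $\mathbb{R}^d$ with common law $\nu$, where $\nu$ has a density (with respect to Lebesgue measure) of finite essential supremum. Let $r=r(n)>0$ with $r(n)\to0$ and $q=q(n)\in[0,1]$. Let $G_n$ be the graph on $X_1,\dots,X_n$ in which distinct $X_i,X_j$ are adjacent iff $\|X_i-X_j\|\le r(n)$, and let $G_n^{0,q}$ be obtained from $G_n$ by inserting each non-edge independently with probability $q(n)$. An edge $uv$ of $G_n^{0,q}$ is long if $\|u-v\|>3r(n)$; for an edge $uv$ of a graph $G$, $\omega_{u,v}(G)$ is the largest size of a clique of $G$ containing $u$ and $v$. Suppose that $n\,r(n)^d\le n^{-\alpha}$ for all sufficiently large $n$, for some fixed $\alpha\in(0,1/\beta^2]$. Then: (a) There are constants $C_1,C_2>0$, depending only on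 $\beta$ and $\alpha$, such that if $q(n)\le C_1 n^{-C_2}$ for all sufficiently large $n$, then there is a constant $K>0$ with $$\lim_{n\to\infty}\mathbb{P}\big[\omega_{u,v}(G_n^{0,q})\le K\ \text{for every long edge } uv \text{ of } G_n^{0,q}\big]=1 .$$ (b) There is a constant $\xi>0$, depending only on $\beta$ and $\alpha$, such that if $n^{-\xi}\le q(n)<1$ for all sufficiently large $n$, then there is a constant $K>0$ with $$\lim_{n\to\infty}\mathbb{P}\big[\omega_{u,v}(G_n^{0,q})\le K\log_{1/q(n)}n\ \text{for every long edge } uv \text{ of } G_n^{0,q}\big]=1 .$$ -/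

import Mathlib

open MeasureTheory Filter Topology

/-- `β` is an admissible Besicovitch constant of `ℝ^d` with the norm `N`: for every set `P` and
every `δ > 0` there are `β` many `δ`-packings with centres in `P` (the `i`-th one consists of the
closed `N`-balls of radius `δ` around the points of `c i`) whose union covers `P`. -/
def IsBesicovitchConstant {d : ℕ} (N : Seminorm ℝ (Fin d → ℝ)) (β : ℕ) : Prop :=
  ∀ (P : Set (Fin d → ℝ)) (δ : ℝ), 0 < δ →
    ∃ c : Fin β → Set (Fin d → ℝ),
      (∀ i, c i ⊆ P ∧ (c i).Countable ∧ (c i).PairwiseDisjoint (fun x => N.closedBall x δ)) ∧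
      P ⊆ ⋃ i, ⋃ x ∈ c i, N.closedBall x δ

/-- `ν` has a density with respect to Lebesgue measure whose essential supremum (the maximum
density of `ν`) is finite. -/
def HasFiniteMaxDensity {d : ℕ} (ν : Measure (Fin d → ℝ)) : Prop :=
  ∃ f : (Fin d → ℝ) → ENNReal,
    Measurable f ∧ ν = volume.withDensity f ∧ essSup f volume < ⊤

/-- The standing assumptions on the space, on the distribution of the points and on the radii:
`N` is a norm on `ℝ^d` with Besicovitch constant `β`, `ν` is a probability distribution with
finite maximum density, and `r` is a sequence of positive radii tending to `0`. -/
structure StandardSetting {d : ℕ} (N : Seminorm ℝ (Fin d → ℝ)) (β : ℕ)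
    (ν : Measure (Fin d → ℝ)) (r : ℕ → ℝ) : Prop where
  norm_definite : ∀ x, N x = 0 → x = 0
  besicovitch : IsBesicovitchConstant N β
  probability : IsProbabilityMeasure ν
  density : HasFiniteMaxDensity ν
  radius_pos : ∀ n, 0 < r n
  radius_tendsto : Tendsto r atTop (𝓝 0)

/-- The geometric graph of the points `x 0, …, x (n - 1)` with radius `r`. -/
def geometricGraph {d n : ℕ} (N : Seminorm ℝ (Fin d → ℝ)) (r : ℝ) (x : Fin n → Fin d → ℝ) :
    SimpleGraph (Fin n) where
  Adj i j := i ≠ j ∧ N (x i - x j) ≤ r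
  symm := ⟨fun i j h => ⟨h.1.symm, by rw [map_sub_rev]; exact h.2⟩⟩
  loopless := ⟨fun _ h => h.1 rfl⟩

/-- Delete from `G` the edges marked in `D`, and insert the non-edges of `G` marked in `I`. -/
def perturb {V : Type*} (G D I : SimpleGraph V) : SimpleGraph V := (G \ D) ⊔ (I \ G)

/-- The randomness of the `(p, q)`-perturbed random geometric graph on `n` vertices: `n`
independent points with law `ν`, and independently of them two independent random sets of pairs of
vertices, in which every pair is marked independently with probability `p` (for deletion),
respectively `q` (for insertion). -/
noncomputable def noisyLaw {d : ℕ} (ν : Measure (Fin d → ℝ)) (n : ℕ) (p q : unitInterval) :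
    Measure ((Fin n → Fin d → ℝ) × (SimpleGraph (Fin n) × SimpleGraph (Fin n))) :=
  (Measure.pi fun _ : Fin n => ν).prod
    ((SimpleGraph.binomialRandom (Fin n) p).prod (SimpleGraph.binomialRandom (Fin n) q))

/-- The perturbed random geometric graph with radius `r`, as a function of the randomness
`ω = (points, (deletion marks, insertion marks))`. -/
def noisyGraph {d n : ℕ} (N : Seminorm ℝ (Fin d → ℝ)) (r : ℝ)
    (ω : (Fin n → Fin d → ℝ) × (SimpleGraph (Fin n) × SimpleGraph (Fin n))) :
    SimpleGraph (Fin n) :=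
  perturb (geometricGraph N r ω.1) ω.2.1 ω.2.2

/-- `uv` is a long edge of the noisy graph: an edge with `N (x u - x v) > 3 r`. -/
def IsLongEdge {d n : ℕ} (N : Seminorm ℝ (Fin d → ℝ)) (r : ℝ)
    (ω : (Fin n → Fin d → ℝ) × (SimpleGraph (Fin n) × SimpleGraph (Fin n))) (u v : Fin n) : Prop :=
  (noisyGraph N r ω).Adj u v ∧ 3 * r < N (ω.1 u - ω.1 v)

/-- The edge clique number of `uv` in a finite graph `G`: the largest size of a clique of `G`
that contains both `u` and `v`. -/
noncomputable def edgeCliqueNumber {n : ℕ} (G : SimpleGraph (Fin n)) (u v : Fin n) : ℕ :=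
  sSup {k | ∃ s : Finset (Fin n), G.IsNClique k s ∧ u ∈ s ∧ v ∈ s}

/-! In this sparse regime a vertex has expected geometric degree O(n^(-α)), so for a constant `k ≥ 2
/ α` all geometric degrees are below `k` with probability 1 - O(1/n). A clique of size `k * t` in
the noisy graph then contains `t` vertices with no geometric edge among them, and these form a
clique of insertion marks. A first-moment bound excludes such a clique once n^3 q^(t-1) ≤ 1. Hence
every edge has clique number at most `k * t`. A constant `t` suffices for (a), and `t` of order
log_{1/q} n for (b). -/

/-! ### Deterministic clique bound -/

/-- Greedy choice: each selected vertex discards itself and fewer than `k` neighbours, so at most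
`k` vertices. -/
theorem SimpleGraph.exists_indep_subset {V : Type*} (G : SimpleGraph V) {k : ℕ} (hk : 0 < k)
    (hG : ∀ i, ∀ S : Finset V, (∀ j ∈ S, G.Adj i j) → S.card < k) (t : ℕ) (s : Finset V)
    (hs : k * t ≤ s.card) :
    ∃ T ⊆ s, T.card = t ∧ ∀ i ∈ T, ∀ j ∈ T, ¬ G.Adj i j := by
  classical
  induction t generalizing s with
  | zero => exact ⟨∅, by simp, by simp, by simp⟩
  | succ t ih =>
    obtain ⟨v, hv⟩ : s.Nonempty :=
      Finset.card_pos.mp ((Nat.mul_pos hk t.succ_pos).trans_le hs)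
    have hdeg : (s.filter (G.Adj v)).card < k := hG v _ fun j hj => (Finset.mem_filter.mp hj).2
    have hle : s.card - (insert v (s.filter (G.Adj v))).card ≤
        (s \ insert v (s.filter (G.Adj v))).card := Finset.le_card_sdiff _ _
    have hins := Finset.card_insert_le v (s.filter (G.Adj v))
    obtain ⟨T, hTs, hT, hind⟩ := ih (s \ insert v (s.filter (G.Adj v))) (by
      rw [Nat.mul_succ] at hs
      omega)
    have hTv : ∀ j ∈ T, j ≠ v ∧ ¬ G.Adj v j := fun j hj => by
      have := hTs hj
      simp only [Finset.mem_sdiff, Finset.mem_insert, Finset.mem_filter, not_or, not_and] at this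
      exact ⟨this.2.1, this.2.2 this.1⟩
    refine ⟨insert v T, Finset.insert_subset hv (hTs.trans Finset.sdiff_subset), ?_, ?_⟩
    · rw [Finset.card_insert_of_notMem fun h => (hTv v h).1 rfl, hT]
    · intro i hi j hj
      rcases Finset.mem_insert.mp hi with rfl | hi <;> rcases Finset.mem_insert.mp hj with rfl | hj'
      · exact G.irrefl
      · exact (hTv j hj').2
      · exact fun h => (hTv i ‹_›).2 h.symm
      · exact hind i hi j hj'

theorem edgeCliqueNumber_noisyGraph_le {d n : ℕ} {N : Seminorm ℝ (Fin d → ℝ)} {r : ℝ} {k t : ℕ}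
    (hk : 0 < k) {ω : (Fin n → Fin d → ℝ) × (SimpleGraph (Fin n) × SimpleGraph (Fin n))}
    (hdeg : ∀ i, ∀ S : Finset (Fin n), (∀ j ∈ S, (geometricGraph N r ω.1).Adj i j) → S.card < k)
    (hI : ω.2.2.CliqueFree t) (u v : Fin n) :
    edgeCliqueNumber (noisyGraph N r ω) u v ≤ k * t := by
  refine csSup_le' ?_
  rintro m ⟨s, hs, -, -⟩
  by_contra! hm
  obtain ⟨T, hTs, hT, hind⟩ :=
    (geometricGraph N r ω.1).exists_indep_subset hk hdeg t s (hs.card_eq ▸ hm.le)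
  refine hI T ⟨fun i hi j hj hij => ?_, hT⟩
  rcases hs.isClique (hTs hi) (hTs hj) hij with h | h
  · exact absurd h.1 (hind i hi j hj)
  · exact h.1

/-! ### Probability mass of small balls -/

theorem Seminorm.continuous_of_finiteDimensional {d : ℕ} (N : Seminorm ℝ (Fin d → ℝ)) :
    Continuous N :=
  continuousOn_univ.mp (N.convexOn.continuousOn isOpen_univ)

theorem Seminorm.isBounded_closedBall_zero {d : ℕ} {N : Seminorm ℝ (Fin d → ℝ)}
    (hN : ∀ x, N x = 0 → x = 0) (r : ℝ) : Bornology.IsBounded (N.closedBall 0 r) := by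
  obtain ⟨c, hc, hcN⟩ : ∃ c > 0, ∀ x, ‖x‖ = 1 → c ≤ N x := by
    rcases (Metric.sphere (0 : Fin d → ℝ) 1).eq_empty_or_nonempty with h | h
    -- The unit sphere is empty when `d = 0`; any positive constant works.
    · refine ⟨1, one_pos, fun x hx => ?_⟩
      have : x ∈ Metric.sphere (0 : Fin d → ℝ) 1 := by simpa using hx
      simp [h] at this
    · obtain ⟨y, hy, hmin⟩ := (isCompact_sphere (0 : Fin d → ℝ) 1).exists_isMinOn h
        N.continuous_of_finiteDimensional.continuousOn
      refine ⟨N y, lt_of_le_of_ne (apply_nonneg N y) fun h0 => ?_, fun x hx => ?_⟩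
      · have := hN y h0.symm
        simp [this] at hy
      · exact isMinOn_iff.mp hmin x (by simpa using hx)
  refine isBounded_iff_forall_norm_le.mpr ⟨r / c, fun x hx => ?_⟩
  rw [Seminorm.mem_closedBall_zero] at hx
  rw [le_div_iff₀ hc]
  rcases eq_or_ne x 0 with rfl | hx0
  · simpa using hx
  · have hx' : 0 < ‖x‖ := norm_pos_iff.mpr hx0
    have h := hcN (‖x‖⁻¹ • x) (by rw [norm_smul, norm_inv, norm_norm, inv_mul_cancel₀ hx'.ne'])
    rw [map_smul_eq_mul, norm_inv, norm_norm, inv_mul_eq_div, le_div_iff₀ hx'] at h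
    linarith

theorem HasFiniteMaxDensity.exists_measure_le {d : ℕ} {ν : Measure (Fin d → ℝ)}
    (hν : HasFiniteMaxDensity ν) : ∃ σ : NNReal, ∀ s, MeasurableSet s → ν s ≤ σ * volume s := by
  obtain ⟨f, -, rfl, hf⟩ := hν
  lift essSup f volume to NNReal using hf.ne with σ hσ
  refine ⟨σ, fun s hs => ?_⟩
  rw [withDensity_apply _ hs]
  calc ∫⁻ a in s, f a ≤ ∫⁻ _ in s, (σ : ENNReal) := by
        refine lintegral_mono_ae (ae_restrict_of_ae ?_)
        rw [hσ]
        exact ENNReal.ae_le_essSup f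
    _ = σ * volume s := by simp

open scoped Pointwise in
theorem exists_measure_closedBall_le {d : ℕ} {N : Seminorm ℝ (Fin d → ℝ)}
    {ν : Measure (Fin d → ℝ)} (hN : ∀ x, N x = 0 → x = 0) (hν : HasFiniteMaxDensity ν) :
    ∃ M : NNReal, ∀ (r : ℝ), 0 < r → ∀ x, ν (N.closedBall x r) ≤ M * ENNReal.ofReal (r ^ d) := by
  obtain ⟨σ, hσ⟩ := hν.exists_measure_le
  have hfin : volume (N.closedBall 0 1) ≠ ⊤ := (N.isBounded_closedBall_zero hN 1).measure_lt_top.ne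
  lift volume (N.closedBall 0 1) to NNReal using hfin with V hV
  refine ⟨σ * V, fun r hr x => ?_⟩
  have hmeas : MeasurableSet (N.closedBall x r) := by
    have : N.closedBall x r = {y | N (y - x) ≤ r} := by ext; simp [Seminorm.mem_closedBall]
    rw [this]
    exact (isClosed_le (N.continuous_of_finiteDimensional.comp (continuous_id.sub continuous_const))
      continuous_const).measurableSet
  refine (hσ _ hmeas).trans ?_
  have hball : N.closedBall x r = x +ᵥ (r • N.closedBall 0 1) := by
    rw [Seminorm.smul_closedBall_zero (by simpa using hr.ne'), Seminorm.vadd_closedBall]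
    simp [abs_of_pos hr]
  rw [hball, measure_vadd, Measure.addHaar_smul, ← hV]
  simp only [Module.finrank_fin_fun, ENNReal.coe_mul, abs_of_pos (pow_pos hr d)]
  rw [mul_comm (ENNReal.ofReal _), mul_assoc]

/-! ### First-moment bounds for degrees and inserted cliques -/

/-- Once `x i` is fixed by Fubini, the remaining points fall into the ball around it independently.
-/
theorem pi_forall_close_le {d n : ℕ} {N : Seminorm ℝ (Fin d → ℝ)} {ν : Measure (Fin d → ℝ)}
    [IsProbabilityMeasure ν] {r : ℝ} {b : ENNReal} (hb : ∀ x, ν (N.closedBall x r) ≤ b)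
    (i : Fin (n + 1)) (S : Finset (Fin n)) :
    Measure.pi (fun _ : Fin (n + 1) => ν) {x | ∀ j ∈ S, N (x i - x (i.succAbove j)) ≤ r} ≤
      b ^ S.card := by
  have hN := N.continuous_of_finiteDimensional
  let A : Set ((Fin d → ℝ) × (Fin n → Fin d → ℝ)) := {p | ∀ j ∈ S, N (p.1 - p.2 j) ≤ r}
  have hA : MeasurableSet A := by
    have : A = ⋂ j ∈ S, {p | N (p.1 - p.2 j) ≤ r} := by ext; simp [A]
    rw [this]
    exact (isClosed_biInter fun j _ => isClosed_le (by fun_prop) (by fun_prop)).measurableSet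
  have hmp := measurePreserving_piFinSuccAbove (fun _ : Fin (n + 1) => ν) i
  have hpre : {x : Fin (n + 1) → Fin d → ℝ | ∀ j ∈ S, N (x i - x (i.succAbove j)) ≤ r} =
      MeasurableEquiv.piFinSuccAbove (fun _ => Fin d → ℝ) i ⁻¹' A := rfl
  rw [hpre, hmp.measure_preimage hA.nullMeasurableSet, Measure.prod_apply hA]
  calc _ ≤ ∫⁻ _, b ^ S.card ∂ν := lintegral_mono fun x => ?_
    _ = b ^ S.card := by simp
  have hslice : Prod.mk x ⁻¹' A = (S : Set (Fin n)).pi fun _ => N.closedBall x r := by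
    ext y
    simp [A, Set.mem_pi, Seminorm.mem_closedBall, map_sub_rev N x]
  rw [hslice, Measure.pi_pi_finset]
  exact Finset.prod_le_pow_card _ _ _ fun _ _ => hb x

theorem pi_exists_degree_le {d n : ℕ} {N : Seminorm ℝ (Fin d → ℝ)} {ν : Measure (Fin d → ℝ)}
    [IsProbabilityMeasure ν] {r : ℝ} {b : ENNReal} (hb : ∀ x, ν (N.closedBall x r) ≤ b) (k : ℕ) :
    Measure.pi (fun _ : Fin n => ν)
      {x | ∃ i, ∃ S : Finset (Fin n), (∀ j ∈ S, (geometricGraph N r x).Adj i j) ∧ k ≤ S.card} ≤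
      n * (n * b) ^ k := by
  classical
  rcases n with _ | n
  · simp
  have hsub : {x : Fin (n + 1) → Fin d → ℝ | ∃ i, ∃ S : Finset (Fin (n + 1)),
      (∀ j ∈ S, (geometricGraph N r x).Adj i j) ∧ k ≤ S.card} ⊆
      ⋃ p ∈ (Finset.univ : Finset (Fin (n + 1))) ×ˢ Finset.powersetCard k (Finset.univ),
        {x | ∀ j ∈ p.2, N (x p.1 - x (p.1.succAbove j)) ≤ r} := by
    rintro x ⟨i, S, hS, hcard⟩
    have hcard' : k ≤ (Finset.univ.filter fun j => i.succAbove j ∈ S).card := by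
      refine hcard.trans ?_
      rw [← Finset.card_map (Fin.succAboveEmb i)]
      refine Finset.card_le_card fun j hj => ?_
      obtain ⟨j', rfl⟩ := Fin.exists_succAbove_eq (hS j hj).1.symm
      simpa using hj
    obtain ⟨T, hT, hTk⟩ := Finset.exists_subset_card_eq hcard'
    simp only [Set.mem_iUnion]
    refine ⟨(i, T), by simp [hTk], fun j hj => (hS _ (Finset.mem_filter.mp (hT hj)).2).2⟩
  refine (measure_mono hsub).trans ((measure_biUnion_finset_le _ _).trans ?_)
  calc _ ≤ ∑ p ∈ (Finset.univ : Finset (Fin (n + 1))) ×ˢ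
          Finset.powersetCard k (Finset.univ : Finset (Fin n)), b ^ k := by
        refine Finset.sum_le_sum fun p hp => ?_
        have := pi_forall_close_le hb p.1 p.2
        rwa [(Finset.mem_powersetCard.mp (Finset.mem_product.mp hp).2).2] at this
    _ = ((n + 1 : ℕ) : ENNReal) * ((n.choose k : ℕ) * b ^ k) := by
        simp [Finset.card_product, mul_assoc]
    _ ≤ ((n + 1 : ℕ) : ENNReal) * (((n + 1 : ℕ) : ENNReal) * b) ^ k := by
        rw [mul_pow]
        gcongr
        exact_mod_cast (Nat.choose_le_pow n k).trans (Nat.pow_le_pow_left n.le_succ k)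

theorem binomialRandom_isClique_le {V : Type*} [Finite V] (q : unitInterval) (s : Finset V) :
    SimpleGraph.binomialRandom V q {G | G.IsClique s} ≤
      (unitInterval.toNNReal q : ENNReal) ^ s.card.choose 2 := by
  classical
  -- The unordered pairs within `s`, whose marks are independent.
  let T : Finset (Sym2 V) := s.offDiag.image Sym2.mk.uncurry
  have hT : T.card = s.card.choose 2 := Sym2.card_image_offDiag s
  have hdiag : ∀ e ∈ T, ¬ e.IsDiag := by
    intro e he
    obtain ⟨⟨i, j⟩, hij, rfl⟩ := Finset.mem_image.mp he
    simpa using (Finset.mem_offDiag.mp hij).2.2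
  rw [SimpleGraph.binomialRandom_apply]
  refine (measure_mono (t := (T : Set (Sym2 V)).pi fun _ => {True}) ?_).trans ?_
  · rintro _ ⟨G, hG, rfl⟩ e he
    obtain ⟨⟨i, j⟩, hij, rfl⟩ := Finset.mem_image.mp he
    obtain ⟨hi, hj, hne⟩ := Finset.mem_offDiag.mp hij
    simpa using hG hi hj hne
  · rw [Measure.infinitePi_pi _ fun _ _ => .of_discrete, ← hT]
    refine Finset.prod_le_pow_card _ _ _ fun e he => ?_
    simp [hdiag e he]

theorem binomialRandom_not_cliqueFree_le {V : Type*} [Fintype V] (q : unitInterval) (t : ℕ) :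
    SimpleGraph.binomialRandom V q {G | ¬ G.CliqueFree t} ≤
      (Fintype.card V : ENNReal) ^ t * (unitInterval.toNNReal q : ENNReal) ^ t.choose 2 := by
  have hsub : {G : SimpleGraph V | ¬ G.CliqueFree t} ⊆
      ⋃ s ∈ Finset.powersetCard t (Finset.univ : Finset V), {G | G.IsClique s} := by
    intro G hG
    obtain ⟨s, hs⟩ := not_forall_not.mp hG
    simp only [Set.mem_iUnion]
    exact ⟨s, by simp [hs.card_eq], hs.isClique⟩
  refine (measure_mono hsub).trans ((measure_biUnion_finset_le _ _).trans ?_)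
  calc _ ≤ ∑ s ∈ Finset.powersetCard t (Finset.univ : Finset V),
          (unitInterval.toNNReal q : ENNReal) ^ t.choose 2 := by
        refine Finset.sum_le_sum fun s hs => ?_
        have := binomialRandom_isClique_le q s
        rwa [(Finset.mem_powersetCard.mp hs).2] at this
    _ = ((Fintype.card V).choose t : ℕ) * (unitInterval.toNNReal q : ENNReal) ^ t.choose 2 := by
        simp [Finset.card_univ]
    _ ≤ _ := by
        gcongr
        exact_mod_cast Nat.choose_le_pow _ t

/-! ### Combining the bounds and passing to the limit -/

/-- The probability that the edge clique numbers are not bounded by `k * t`. -/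
theorem noisyLaw_exists_lt_edgeCliqueNumber_le {d n : ℕ} {N : Seminorm ℝ (Fin d → ℝ)}
    {ν : Measure (Fin d → ℝ)} [IsProbabilityMeasure ν] {r : ℝ} {b : ENNReal}
    (hb : ∀ x, ν (N.closedBall x r) ≤ b) {k : ℕ} (hk : 0 < k) (t : ℕ) (p q : unitInterval) :
    noisyLaw ν n p q {ω | ∃ u v, k * t < edgeCliqueNumber (noisyGraph N r ω) u v} ≤
      n * (n * b) ^ k + (n : ENNReal) ^ t * (unitInterval.toNNReal q : ENNReal) ^ t.choose 2 := by
  let A : Set (Fin n → Fin d → ℝ) :=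
    {x | ∃ i, ∃ S : Finset (Fin n), (∀ j ∈ S, (geometricGraph N r x).Adj i j) ∧ k ≤ S.card}
  let B : Set (SimpleGraph (Fin n)) := {G | ¬ G.CliqueFree t}
  have hsub : {ω : (Fin n → Fin d → ℝ) × (SimpleGraph (Fin n) × SimpleGraph (Fin n)) |
      ∃ u v, k * t < edgeCliqueNumber (noisyGraph N r ω) u v} ⊆
      A ×ˢ Set.univ ∪ Set.univ ×ˢ (Set.univ ×ˢ B) := by
    rintro ω ⟨u, v, huv⟩
    by_contra hω
    simp only [Set.mem_union, Set.mem_prod, Set.mem_univ, and_true, true_and, not_or] at hω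
    obtain ⟨hA, hB⟩ := hω
    refine huv.not_ge (edgeCliqueNumber_noisyGraph_le hk (fun i S hS => ?_) (not_not.mp hB) u v)
    by_contra! h
    exact hA ⟨i, S, hS, h⟩
  refine (measure_mono hsub).trans ((measure_union_le _ _).trans (add_le_add ?_ ?_))
  · rw [noisyLaw, Measure.prod_prod, measure_univ, mul_one]
    exact pi_exists_degree_le hb k
  · rw [noisyLaw, Measure.prod_prod, Measure.prod_prod, measure_univ, measure_univ, one_mul,
      one_mul]
    simpa using binomialRandom_not_cliqueFree_le (V := Fin n) q t

instance {d n : ℕ} (ν : Measure (Fin d → ℝ)) [IsProbabilityMeasure ν] (p q : unitInterval) :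
    IsProbabilityMeasure (noisyLaw ν n p q) := by
  unfold noisyLaw
  infer_instance

/-- Squaring clears the half in `t.choose 2`; absorbing n^2 into n^t, where `2 ≤ t` enters, leaves
(n^3 q^(t-1))^t. -/
theorem pow_mul_pow_choose_two_le {n t : ℕ} {q : ℝ} (hn : 1 ≤ n) (ht : 2 ≤ t) (hq : 0 ≤ q)
    (h : (n : ℝ) ^ 3 * q ^ (t - 1) ≤ 1) : (n : ℝ) ^ t * q ^ t.choose 2 ≤ 1 / n := by
  have hn' : (1 : ℝ) ≤ n := by exact_mod_cast hn
  have hn0 : (0 : ℝ) < n := by positivity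
  rw [le_div_iff₀ hn0, ← one_pow (M := ℝ) 1]
  refine (pow_le_one_iff_of_nonneg (by positivity) two_ne_zero).mp ?_ |>.trans (by simp)
  have hch : t.choose 2 * 2 = t * (t - 1) := by
    rw [Nat.choose_two_right, Nat.div_mul_cancel (Nat.even_mul_pred_self t).two_dvd]
  calc ((n : ℝ) ^ t * q ^ t.choose 2 * n) ^ 2
      = n ^ 2 * (n ^ 2) ^ t * (q ^ (t - 1)) ^ t := by
        rw [← pow_mul q, mul_comm (t - 1), ← hch, pow_mul q]
        ring
    _ ≤ n ^ t * (n ^ 2) ^ t * (q ^ (t - 1)) ^ t := by gcongr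
    _ = (n ^ 3 * q ^ (t - 1)) ^ t := by rw [← mul_pow, ← mul_pow]; ring
    _ ≤ 1 := pow_le_one₀ (by positivity) h

theorem tendsto_one_of_measure_compl_le {Ω : ℕ → Type*} [∀ n, MeasurableSpace (Ω n)]
    {μ : ∀ n, Measure (Ω n)} [∀ n, IsProbabilityMeasure (μ n)] {A : ∀ n, Set (Ω n)}
    {ε : ℕ → ENNReal} (hε : Tendsto ε atTop (𝓝 0)) (hA : ∀ᶠ n in atTop, μ n (A n)ᶜ ≤ ε n) :
    Tendsto (fun n => μ n (A n)) atTop (𝓝 1) := by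
  have h1 : Tendsto (fun n => 1 - ε n) atTop (𝓝 1) := by
    simpa using ENNReal.Tendsto.sub tendsto_const_nhds hε (Or.inl ENNReal.one_ne_top)
  refine tendsto_of_tendsto_of_tendsto_of_le_of_le' h1 tendsto_const_nhds ?_
    (.of_forall fun n => prob_le_one)
  filter_upwards [hA] with n hn
  rw [tsub_le_iff_right]
  -- Subadditivity avoids any measurability requirement on `A n`.
  calc (1 : ENNReal) = μ n (A n ∪ (A n)ᶜ) := by simp
    _ ≤ μ n (A n) + μ n (A n)ᶜ := measure_union_le _ _
    _ ≤ _ := by gcongr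

/-- In the sparse regime the noisy graph has small edge clique numbers with high probability,
provided that cliques of size `t n` of inserted edges are unlikely. -/
theorem exists_tendsto_noisyLaw {α : ℝ} (hα : 0 < α) :
    ∃ k : ℕ, 0 < k ∧ ∀ {d : ℕ} {N : Seminorm ℝ (Fin d → ℝ)} {β : ℕ} {ν : Measure (Fin d → ℝ)}
      {r : ℕ → ℝ} {q : ℕ → unitInterval} {t : ℕ → ℕ} {b : ℕ → ℝ}, StandardSetting N β ν r →
      (∀ᶠ n : ℕ in atTop, (n : ℝ) * r n ^ d ≤ (n : ℝ) ^ (-α)) →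
      (∀ᶠ n : ℕ in atTop, 2 ≤ t n ∧ (n : ℝ) ^ 3 * (q n : ℝ) ^ (t n - 1) ≤ 1 ∧
        ((k * t n : ℕ) : ℝ) ≤ b n) →
      Tendsto (fun n : ℕ => noisyLaw ν n 0 (q n)
        {ω | ∀ u v, IsLongEdge N (r n) ω u v →
          (edgeCliqueNumber (noisyGraph N (r n) ω) u v : ℝ) ≤ b n}) atTop (𝓝 1) := by
  -- With `k * α ≥ 2`, the degree bound n · (n^(-α))^k is at most 1/n.
  obtain ⟨k, hk⟩ := exists_nat_ge (2 / α)
  have hk0 : 0 < k := by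
    have : (0 : ℝ) < k := (by positivity : 0 < 2 / α).trans_le hk
    exact_mod_cast this
  refine ⟨k, hk0, ?_⟩
  intro d N β ν r q t b hS hr ht
  have := hS.probability
  obtain ⟨M, hM⟩ := exists_measure_closedBall_le hS.norm_definite hS.density
  refine tendsto_one_of_measure_compl_le
    (ε := fun n : ℕ => ENNReal.ofReal (((M : ℝ) ^ k + 1) * (1 / (n : ℝ)))) ?_ ?_
  · rw [← ENNReal.ofReal_zero]
    refine (ENNReal.continuous_ofReal.tendsto 0).comp ?_
    simpa using (tendsto_one_div_atTop_nhds_zero_nat (𝕜 := ℝ)).const_mul ((M : ℝ) ^ k + 1)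
  filter_upwards [hr, ht, eventually_ge_atTop 1] with n hrn ⟨htn, hqn, hbn⟩ hn
  have hrpos := hS.radius_pos n
  have hn' : (1 : ℝ) ≤ n := by exact_mod_cast hn
  have hn0 : (0 : ℝ) < n := by positivity
  refine (measure_mono ?_).trans ((noisyLaw_exists_lt_edgeCliqueNumber_le
    (hM (r n) hrpos) hk0 (t n) 0 (q n)).trans ?_)
  · intro ω hω
    simp only [Set.mem_compl_iff, Set.mem_ofPred_eq, not_forall, not_le] at hω
    obtain ⟨u, v, -, huv⟩ := hω
    exact ⟨u, v, by exact_mod_cast hbn.trans_lt huv⟩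
  · have hq0 : 0 ≤ (q n : ℝ) := (q n).2.1
    have hqe : ((unitInterval.toNNReal (q n) : NNReal) : ENNReal) = ENNReal.ofReal (q n : ℝ) := by
      rw [← ENNReal.ofReal_coe_nnreal]
      rfl
    have hMe : (M : ENNReal) = ENNReal.ofReal (M : ℝ) := (ENNReal.ofReal_coe_nnreal).symm
    rw [hqe, hMe, ← ENNReal.ofReal_natCast, ← ENNReal.ofReal_mul (by positivity),
      ← ENNReal.ofReal_mul (by positivity), ← ENNReal.ofReal_pow (by positivity),
      ← ENNReal.ofReal_mul (by positivity), ← ENNReal.ofReal_pow (by positivity),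
      ← ENNReal.ofReal_pow (by positivity), ← ENNReal.ofReal_mul (by positivity),
      ← ENNReal.ofReal_add (by positivity) (by positivity)]
    refine ENNReal.ofReal_le_ofReal ?_
    rw [add_mul, one_mul]
    refine add_le_add ?_ (pow_mul_pow_choose_two_le hn htn hq0 hqn)
    have hpow : ((n : ℝ) ^ (-α)) ^ k ≤ (n : ℝ) ^ (-2 : ℝ) := by
      rw [← Real.rpow_mul_natCast hn0.le]
      refine Real.rpow_le_rpow_of_exponent_le hn' ?_
      rw [div_le_iff₀ hα] at hk
      linarith
    calc (n : ℝ) * (n * (M * r n ^ d)) ^ k = n * M ^ k * (n * r n ^ d) ^ k := by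
          rw [mul_left_comm (n : ℝ) (M : ℝ), mul_pow (M : ℝ)]
          ring
      _ ≤ n * M ^ k * ((n : ℝ) ^ (-α)) ^ k := by gcongr
      _ ≤ n * M ^ k * (n : ℝ) ^ (-2 : ℝ) := by gcongr
      _ = M ^ k * (1 / n) := by
          rw [Real.rpow_neg hn0.le, Real.rpow_two]
          field_simp

theorem theorem3p4 (β : ℕ) (α : ℝ) (hα : 0 < α) (hαβ : α ≤ 1 / (β : ℝ) ^ 2) :
    (∃ C₁ > (0 : ℝ), ∃ C₂ > (0 : ℝ),
      ∀ (d : ℕ) (N : Seminorm ℝ (Fin d → ℝ)) (ν : Measure (Fin d → ℝ)) (r : ℕ → ℝ)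
        (q : ℕ → unitInterval),
        StandardSetting N β ν r →
        (∀ᶠ n : ℕ in atTop, (n : ℝ) * r n ^ d ≤ (n : ℝ) ^ (-α)) →
        (∀ᶠ n : ℕ in atTop, (q n : ℝ) ≤ C₁ * (1 / (n : ℝ)) ^ C₂) →
        ∃ K > (0 : ℝ), Tendsto
          (fun n : ℕ => noisyLaw ν n 0 (q n)
            {ω | ∀ u v, IsLongEdge N (r n) ω u v →
              (edgeCliqueNumber (noisyGraph N (r n) ω) u v : ℝ) ≤ K})
          atTop (𝓝 1)) ∧
    (∃ ξ > (0 : ℝ),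
      ∀ (d : ℕ) (N : Seminorm ℝ (Fin d → ℝ)) (ν : Measure (Fin d → ℝ)) (r : ℕ → ℝ)
        (q : ℕ → unitInterval),
        StandardSetting N β ν r →
        (∀ᶠ n : ℕ in atTop, (n : ℝ) * r n ^ d ≤ (n : ℝ) ^ (-α)) →
        (∀ᶠ n : ℕ in atTop, (1 / (n : ℝ)) ^ ξ ≤ (q n : ℝ) ∧ (q n : ℝ) < 1) →
        ∃ K > (0 : ℝ), Tendsto
          (fun n : ℕ => noisyLaw ν n 0 (q n)
            {ω | ∀ u v, IsLongEdge N (r n) ω u v →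
              (edgeCliqueNumber (noisyGraph N (r n) ω) u v : ℝ) ≤
                K * Real.logb (1 / (q n : ℝ)) (n : ℝ)})
          atTop (𝓝 1)) := by
  obtain ⟨k, hk, key⟩ := exists_tendsto_noisyLaw hα
  refine ⟨⟨1, one_pos, 1, one_pos, fun d N ν r q hS hr hq => ?_⟩,
    ⟨1, one_pos, fun d N ν r q hS hr hq => ?_⟩⟩
  -- For `t = 4` the condition reads (nq)^3 ≤ 1, which is why q ≤ 1/n is enough.
  · refine ⟨(k * 4 : ℕ), by positivity, key (t := fun _ => 4) hS hr ?_⟩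
    filter_upwards [hq, eventually_ge_atTop 1] with n hqn hn
    have hn0 : (0 : ℝ) < n := by exact_mod_cast hn
    refine ⟨by norm_num, ?_, le_rfl⟩
    rw [one_mul, Real.rpow_one, le_div_iff₀ hn0] at hqn
    rw [← mul_pow, mul_comm]
    exact pow_le_one₀ (mul_nonneg (q n).2.1 hn0.le) hqn
  -- Here q^(t-1) ≤ q^(3L) = n^(-3) with L = log_{1/q} n. Since q ≥ 1/n gives L ≥ 1, rounding costs
  -- little: `t` ≤ 3L + 2 ≤ 5L.
  · refine ⟨5 * k, by positivity,
      key (t := fun n => ⌈3 * Real.logb (1 / (q n : ℝ)) n⌉₊ + 1) hS hr ?_⟩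
    filter_upwards [hq, eventually_ge_atTop 2] with n ⟨hqn, hq1⟩ hn
    have hn' : (2 : ℝ) ≤ n := by exact_mod_cast hn
    have hn0 : (0 : ℝ) < n := by positivity
    rw [Real.rpow_one] at hqn
    have hq0 : 0 < (q n : ℝ) := (by positivity : (0 : ℝ) < 1 / n).trans_le hqn
    have hb : 1 < 1 / (q n : ℝ) := one_lt_one_div hq0 hq1
    set L := Real.logb (1 / (q n : ℝ)) n with hL
    have hL1 : 1 ≤ L := by
      rw [hL, Real.le_logb_iff_rpow_le hb hn0, Real.rpow_one]
      exact (one_div_le hq0 hn0).mpr hqn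
    have hceil := Nat.le_ceil (3 * L)
    have hceil' := Nat.ceil_lt_add_one (by positivity : 0 ≤ 3 * L)
    refine ⟨?_, ?_, ?_⟩
    · have : 0 < ⌈3 * L⌉₊ := Nat.ceil_pos.mpr (by positivity)
      omega
    · have hpow : (n : ℝ) ^ 3 ≤ (1 / (q n : ℝ)) ^ ⌈3 * L⌉₊ := by
        calc (n : ℝ) ^ 3 = (1 / (q n : ℝ)) ^ (L * (3 : ℕ)) := by
              rw [Real.rpow_mul_natCast (by positivity), hL, Real.rpow_logb (by positivity) hb.ne' hn0]
          _ ≤ (1 / (q n : ℝ)) ^ (⌈3 * L⌉₊ : ℝ) :=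
              Real.rpow_le_rpow_of_exponent_le hb.le (by push_cast; linarith)
          _ = _ := Real.rpow_natCast _ _
      rw [one_div, inv_pow, ← one_div, le_div_iff₀ (by positivity)] at hpow
      simpa using hpow
    · have hk0 : (0 : ℝ) ≤ k := k.cast_nonneg
      push_cast
      nlinarith
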